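/- Let $a:[0,1]\to\mathbb R$ be weakly degenerate at $0$ (WD), i.e. $a\in C[0,1]\cap C^1(0,1]$, $a(0)=0$, $a>0$ on $(0,1]$ and $K:=\sup_{x\in(0,1]}\frac{x|a'(x)|}{a(x)}\in(0,1)$, or strongly degenerate at $0$ (SD), i.e. $a\in C^1[0,1]$, $a(0)=0$, $a>0$ on $(0,1]$ and $K\in[1,2)$. Let $\beta,\gamma\ge 0$. Notation. All functions are real-valued, on $(0,1)$, up to equality almost everywhere, and derivatives are weak derivatives. $L^2_{1/a}$ is the space of $u\in L^2(0,1)$ with $\|u\|^2_{L^2_{1/a}}:=\int_0^1 \frac{u^2}{a}\,dx<\infty$. Put $H^1_{1/a,0}:=\{u\in L^2_{1/a}\cap H^1(0,1): u(0)=0\}$ and $H^2_{1/a,0}:=\{u\in H^1_{1/a,0}\cap H^2(0,1): u'(0)=0\}$. The operator $A$ is $Au:=au''''$ with domain $D(A):=\{u\in H^2_{1/a,0}: au''''\in L^2_{1/a}\}$. Finally, $C_{HP}$ is the best (least) constant $C$ such that $\int_0^1\frac{u^2}{a}\,dx\le C\int_0^1(u')^2\,dx$ for all $u\in H^1_{1/a,0}$;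 it exists and $C_{HP}>0$. For $z\in H^2_{1/a,0}$ define $|||z|||\ge 0$ by $$|||z|||^2:=\int_0^1 (z'')^2\,dx+\beta z(1)^2+\gamma z'(1)^2 .$$ Then $|||\cdot|||$ and $\|z\|_{2,\sim}:=\|z''\|_{L^2(0,1)}$ are equivalent norms on $H^2_{1/a,0}$. Moreover, for all $\lambda,\mu\in\mathbb R$ the variational problem $$\int_0^1 z''\varphi''\,dx+\beta z(1)\varphi(1)+\gamma z'(1)\varphi'(1)=\lambda\varphi(1)+\mu\varphi'(1)\qquad\text{for all }\varphi\in H^2_{1/a,0}$$ has a unique solution $z\in H^2_{1/a,0}$. This solution satisfies $$\|z\|^2_{L^2_{1/a}}\le (4C_{HP}+1)(|\lambda|+|\mu|)^2\quad\text{and}\quad |||z|||^2\le(|\lambda|+|\mu|)^2 .$$ In addition $z\in D(A)$, and $z$ solves $$Az=0\ \text{ a.e. in } (0,1),\qquad \beta z(1)-z'''(1)=\lambda,\qquad \gamma z'(1)+z''(1)=\mu .$$ -/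

import Mathlib

open MeasureTheory Set Filter Topology
open scoped ContDiff

noncomputable section

namespace DegBeam

/-- Lebesgue measure on the interval `(0,1)`. -/
abbrev vol01 : Measure ℝ := volume.restrict (Ioo (0 : ℝ) 1)

/-- Real functions on `(0,1)` modulo equality almost everywhere. -/
abbrev Fun01 : Type := ℝ →ₘ[vol01] ℝ

/-! ### The coefficient -/

/-- The quotients `x |a'(x)| / a(x)`, `x ∈ (0,1]` (one-sided derivative at `1`), whose supremum
measures the degeneracy of `a` at `0`. -/
def degeneracyRatios (a : ℝ → ℝ) : Set ℝ :=
  (fun x => x * |derivWithin a (Icc 0 1) x| / a x) '' Ioc 0 1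

/-- `a` is weakly degenerate at `0`. -/
structure IsWD (a : ℝ → ℝ) : Prop where
  continuousOn : ContinuousOn a (Icc 0 1)
  contDiffOn : ContDiffOn ℝ 1 a (Ioc 0 1)
  zero : a 0 = 0
  pos : ∀ x ∈ Ioc (0 : ℝ) 1, 0 < a x
  sup_mem : ∃ K ∈ Ioo (0 : ℝ) 1, IsLUB (degeneracyRatios a) K

/-- `a` is strongly degenerate at `0`. -/
structure IsSD (a : ℝ → ℝ) : Prop where
  contDiffOn : ContDiffOn ℝ 1 a (Icc 0 1)
  zero : a 0 = 0
  pos : ∀ x ∈ Ioc (0 : ℝ) 1, 0 < a x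
  sup_mem : ∃ K ∈ Ico (1 : ℝ) 2, IsLUB (degeneracyRatios a) K

/-! ### Weak derivatives and point values -/

/-- `v` is the weak derivative of `u` on `(0,1)`: both are locally integrable on `(0,1)`, and
`∫ u φ' = - ∫ v φ` for all test functions `φ ∈ C_c^∞(0,1)`. -/
def IsWeakDeriv (u v : Fun01) : Prop :=
  LocallyIntegrableOn u (Ioo 0 1) volume ∧ LocallyIntegrableOn v (Ioo 0 1) volume ∧
    ∀ φ : ℝ → ℝ, ContDiff ℝ ∞ φ → HasCompactSupport φ → tsupport φ ⊆ Ioo 0 1 →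
      ∫ x, u x * deriv φ x ∂vol01 = - ∫ x, v x * φ x ∂vol01

/-- A weak derivative is unique, so that the choice in `weakDeriv` below is harmless. -/
theorem IsWeakDeriv.unique {u v w : Fun01} (hv : IsWeakDeriv u v) (hw : IsWeakDeriv u w) :
    v = w := by
  have hint : ∀ f : Fun01, LocallyIntegrableOn f (Ioo 0 1) volume → ∀ φ : ℝ → ℝ,
      ContDiff ℝ ∞ φ → HasCompactSupport φ → tsupport φ ⊆ Ioo 0 1 →
      Integrable (fun x => f x * φ x) vol01 := by
    intro f hf φ h1 h2 h3
    have hK : IntegrableOn f (tsupport φ) volume :=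
      hf.integrableOn_compact_subset h3 h2
    have : IntegrableOn (fun x => f x * φ x) (tsupport φ) volume :=
      hK.mul_continuousOn h1.continuous.continuousOn h2
    have h4 : Integrable (fun x => f x * φ x) volume := by
      refine (integrableOn_iff_integrable_of_support_subset ?_).1 this
      intro x hx
      apply subset_tsupport
      intro h0
      exact hx (by simp [h0])
    exact h4.restrict
  have key : ∀ᵐ x ∂(volume : Measure ℝ), x ∈ Ioo (0 : ℝ) 1 → (v x - w x) = 0 := by
    refine IsOpen.ae_eq_zero_of_integral_contDiff_smul_eq_zero isOpen_Ioo
      (hv.2.1.sub hw.2.1) ?_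
    intro φ h1 h2 h3
    have e := (hv.2.2 φ h1 h2 h3).symm.trans (hw.2.2 φ h1 h2 h3)
    have e' : ∫ x, φ x • (v x - w x) ∂vol01 = 0 := by
      have : (fun x => φ x • (v x - w x)) = fun x => v x * φ x - w x * φ x := by
        funext x; simp only [smul_eq_mul]; ring
      rw [this, integral_sub (hint v hv.2.1 φ h1 h2 h3) (hint w hw.2.1 φ h1 h2 h3)]
      linarith
    rw [← e']
    symm
    refine setIntegral_eq_integral_of_forall_compl_eq_zero ?_
    intro x hx
    have : φ x = 0 := image_eq_zero_of_notMem_tsupport fun h => hx (h3 h)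
    simp [this]
  refine AEEqFun.ext ?_
  have := (ae_restrict_iff' (μ := volume) measurableSet_Ioo).2 key
  filter_upwards [this] with x hx
  linarith

/-- `u` has a weak derivative on `(0,1)`. -/
def WeaklyDiff (u : Fun01) : Prop := ∃ v, IsWeakDeriv u v

open Classical in
/-- The weak derivative of `u` (and `0` if there is none). -/
def weakDeriv (u : Fun01) : Fun01 := if h : WeaklyDiff u then h.choose else 0

/-- The `k`-th weak derivative. -/
def D (k : ℕ) (u : Fun01) : Fun01 := weakDeriv^[k] u

/-- `u` has weak derivatives up to the order `k`, all of them locally integrable functions. -/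
def WeaklyDiffUpTo (k : ℕ) (u : Fun01) : Prop := ∀ i < k, WeaklyDiff (D i u)

/-- `u` has the value `c` at the point `x` of `[0,1]`: some representative of `u` is continuous at
`x` (relative to `[0,1]`) and has the value `c` there. -/
def HasValueAt (u : Fun01) (x c : ℝ) : Prop :=
  ∃ g : ℝ → ℝ, u =ᵐ[vol01] g ∧ ContinuousWithinAt g (Icc 0 1) x ∧ g x = c

/-- Point values are unique, so that the choice in `valueAt` below is harmless. -/
theorem HasValueAt.unique {u : Fun01} {x c d : ℝ} (hx : x ∈ Icc (0 : ℝ) 1)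
    (hc : HasValueAt u x c) (hd : HasValueAt u x d) : c = d := by
  obtain ⟨g, hg, hgc, rfl⟩ := hc
  obtain ⟨h, hh, hhc, rfl⟩ := hd
  have hgh : ∀ᵐ y ∂(volume : Measure ℝ), y ∈ Ioo (0 : ℝ) 1 → g y = h y :=
    (ae_restrict_iff' measurableSet_Ioo).1 (hg.symm.trans hh)
  by_contra hne
  have hev : ∀ᶠ y in 𝓝[Icc 0 1] x, g y ≠ h y :=
    (hgc.prodMk_nhds hhc).eventually (isOpen_ne_fun continuous_fst continuous_snd |>.mem_nhds hne)
  obtain ⟨U, hU, hxU, hUs⟩ := mem_nhdsWithin.1 hev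
  have hx' : x ∈ closure (Ioo (0 : ℝ) 1) := by
    rw [closure_Ioo (by norm_num)]; exact hx
  have hpos : 0 < volume (U ∩ Ioo (0 : ℝ) 1) :=
    (hU.inter isOpen_Ioo).measure_pos volume (mem_closure_iff.1 hx' U hU hxU)
  refine hpos.ne' (measure_mono_null ?_ (ae_iff.1 hgh))
  rintro y ⟨hyU, hy⟩ hcon
  exact hUs ⟨hyU, Ioo_subset_Icc_self hy⟩ (hcon hy)

open Classical in
/-- The value of `u` at the point `x` of `[0,1]` (and `0` if there is none). For `u ∈ H¹(0,1)` this
is the value at `x` of the continuous representative of `u` on `[0,1]`. -/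
def valueAt (u : Fun01) (x : ℝ) : ℝ := if h : ∃ c, HasValueAt u x c then h.choose else 0

/-! ### The function spaces -/

/-- Membership in the weighted space `L²_{1/a}(0,1)`. -/
def MemL2w (a f : ℝ → ℝ) : Prop :=
  MemLp f 2 vol01 ∧ Integrable (fun x => f x ^ 2 / a x) vol01

/-- The squared norm of `L²_{1/a}(0,1)`. -/
def normSqL2w (a f : ℝ → ℝ) : ℝ := ∫ x, f x ^ 2 / a x ∂vol01

/-- The Sobolev space `H^k(0,1)`. -/
def H (k : ℕ) : Set Fun01 :=
  {u | WeaklyDiffUpTo k u ∧ ∀ i ≤ k, MemLp (D i u) 2 vol01}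

/-- `H¹_{1/a,0}(0,1)`: the `u ∈ L²_{1/a}(0,1) ∩ H¹(0,1)` with `u(0) = 0`. -/
def H1a0 (a : ℝ → ℝ) : Set Fun01 := {u | MemL2w a u ∧ u ∈ H 1 ∧ valueAt u 0 = 0}

/-- `H²_{1/a,0}(0,1)`: the `u ∈ H¹_{1/a,0}(0,1) ∩ H²(0,1)` with `u'(0) = 0`. -/
def H2a0 (a : ℝ → ℝ) : Set Fun01 := {u | u ∈ H1a0 a ∧ u ∈ H 2 ∧ valueAt (D 1 u) 0 = 0}

/-- The operator `A u = a u''''`. -/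
def opA (a : ℝ → ℝ) (u : Fun01) : ℝ → ℝ := fun x => a x * (D 4 u) x

/-- The domain `D(A)`: the `u ∈ H²_{1/a,0}(0,1)` with `a u'''' ∈ L²_{1/a}(0,1)`. -/
def domA (a : ℝ → ℝ) : Set Fun01 :=
  {u | u ∈ H2a0 a ∧ WeaklyDiffUpTo 4 u ∧ MemL2w a (opA a u)}

/-- The admissible constants in the Hardy-Poincaré inequality
`∫ u²/a ≤ C ∫ (u')²` on `H¹_{1/a,0}(0,1)`. -/
def hardyConstants (a : ℝ → ℝ) : Set ℝ :=
  {C | ∀ u ∈ H1a0 a, ∫ x, u x ^ 2 / a x ∂vol01 ≤ C * ∫ x, (D 1 u) x ^ 2 ∂vol01}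

/-- `C_HP`, the best constant in the Hardy-Poincaré inequality. -/
def CHP (a : ℝ → ℝ) : ℝ := sInf (hardyConstants a)

/-! ### Norms -/

/-- `N` is a norm on the set `S` of functions, which is a linear space. -/
structure IsNormOn (S : Set Fun01) (N : Fun01 → ℝ) : Prop where
  zero_mem : 0 ∈ S
  add_mem : ∀ u ∈ S, ∀ v ∈ S, u + v ∈ S
  smul_mem : ∀ (c : ℝ), ∀ u ∈ S, c • u ∈ S
  add_le : ∀ u ∈ S, ∀ v ∈ S, N (u + v) ≤ N u + N v
  smul_eq : ∀ (c : ℝ), ∀ u ∈ S, N (c • u) = |c| * N u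
  eq_zero : ∀ u ∈ S, N u = 0 → u = 0

/-- `N₁` and `N₂` are equivalent norms on `S`. -/
def EquivNormsOn (S : Set Fun01) (N₁ N₂ : Fun01 → ℝ) : Prop :=
  IsNormOn S N₁ ∧ IsNormOn S N₂ ∧
    ∃ c C : ℝ, 0 < c ∧ 0 < C ∧ ∀ u ∈ S, c * N₂ u ≤ N₁ u ∧ N₁ u ≤ C * N₂ u

/-- `‖z‖_{2,∼} = ‖z''‖_{L²(0,1)}`. -/
def normD2 (z : Fun01) : ℝ := √(∫ x, (D 2 z) x ^ 2 ∂vol01)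

/-- The norm `|||z|||`, given by `|||z|||² = ∫ (z'')² + β z(1)² + γ z'(1)²`. -/
def energyNorm (β γ : ℝ) (z : Fun01) : ℝ :=
  √((∫ x, (D 2 z) x ^ 2 ∂vol01) + β * valueAt z 1 ^ 2 + γ * valueAt (D 1 z) 1 ^ 2)

/-! ### The variational problem -/

/-- `z ∈ H²_{1/a,0}(0,1)` solves the variational problem with data `l`, `m`. -/
def IsVarSol (a : ℝ → ℝ) (β γ l m : ℝ) (z : Fun01) : Prop :=
  z ∈ H2a0 a ∧ ∀ φ ∈ H2a0 a,
    (∫ x, (D 2 z) x * (D 2 φ) x ∂vol01) + β * valueAt z 1 * valueAt φ 1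
        + γ * valueAt (D 1 z) 1 * valueAt (D 1 φ) 1
      = l * valueAt φ 1 + m * valueAt (D 1 φ) 1

end DegBeam

end

namespace DegBeam

/-! The solution is explicit. If z'' is affine, integrating ∫ z''φ'' by parts leaves only φ(1) and
φ'(1) (`IsBending.integral_affine_mul`). Hence z = p x² + q x³ solves the variational problem as
soon as two linear boundary equations in p, q hold (`isVarSol_cubic`). Their determinant βγ + 4β +
12γ + 12 is positive, so no Lax-Milgram argument is needed. The energy form is definite, so every
solution is this cubic. Membership in the domain of A, Az = 0 and the boundary conditions can then
be read off the polynomial.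

The spaces are handled through primitives: by du Bois-Reymond, `H2a0 a` consists exactly of the
double primitives of L² functions (`isBending_of_mem`, `IsBending.mem_H2a0`). The weight enters only
through integrability of x/a (`IsWeight.integrable_id_div`). Indeed x a' ≤ K a makes a x^(-K)
nonincreasing, so a ≥ a(1) x^K with K < 2. Combined with u(x)² ≤ x ∫ (u')², this gives both weighted
integrability and a Hardy-Poincaré inequality.

The norm equivalence and the energy bound rest on |z(1)|, |z'(1)| ≤ ‖z''‖, the latter after testing
with φ = z. The weighted bound adds Hardy-Poincaré and ∫ (z')² ≤ ½ ∫ (z'')². -/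

/-! ### Primitives of integrable functions on the unit interval -/

/-- The primitive of `f` that vanishes at `0`. -/
noncomputable def primitive (f : ℝ → ℝ) (x : ℝ) : ℝ := ∫ t in (0 : ℝ)..x, f t

theorem primitive_zero (f : ℝ → ℝ) : primitive f 0 = 0 := intervalIntegral.integral_same

theorem integrable_vol01_iff {f : ℝ → ℝ} :
    Integrable f vol01 ↔ IntervalIntegrable f volume 0 1 :=
  (intervalIntegrable_iff_integrableOn_Ioo_of_le zero_le_one).symm

theorem integral_vol01 (f : ℝ → ℝ) : ∫ x, f x ∂vol01 = ∫ x in (0 : ℝ)..1, f x := by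
  rw [intervalIntegral.integral_of_le zero_le_one, integral_Ioc_eq_integral_Ioo]

theorem integral_vol01_eq_primitive (f : ℝ → ℝ) : ∫ x, f x ∂vol01 = primitive f 1 :=
  integral_vol01 f

theorem intervalIntegrable_of_integrable_vol01 {f : ℝ → ℝ} (hf : Integrable f vol01) {x : ℝ}
    (hx : x ∈ Icc (0 : ℝ) 1) : IntervalIntegrable f volume 0 x :=
  (integrable_vol01_iff.1 hf).mono_set (by
    rw [uIcc_of_le hx.1, uIcc_of_le zero_le_one]; exact Icc_subset_Icc_right hx.2)

theorem absolutelyContinuous_primitive {f : ℝ → ℝ} (hf : Integrable f vol01) :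
    AbsolutelyContinuousOnInterval (primitive f) 0 1 :=
  (integrable_vol01_iff.1 hf).absolutelyContinuousOnInterval_intervalIntegral
    (by simp)

theorem continuousOn_primitive {f : ℝ → ℝ} (hf : Integrable f vol01) :
    ContinuousOn (primitive f) (Icc 0 1) := by
  simpa using (absolutelyContinuous_primitive hf).continuousOn

theorem integrable_of_continuousOn {f : ℝ → ℝ} (hf : ContinuousOn f (Icc 0 1)) :
    Integrable f vol01 :=
  integrable_vol01_iff.2 (ContinuousOn.intervalIntegrable (by simpa using hf))

theorem integrable_primitive {f : ℝ → ℝ} (hf : Integrable f vol01) :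
    Integrable (primitive f) vol01 :=
  integrable_of_continuousOn (continuousOn_primitive hf)

theorem deriv_primitive_ae {f : ℝ → ℝ} (hf : Integrable f vol01) :
    ∀ᵐ x ∂vol01, deriv (primitive f) x = f x := by
  refine (ae_restrict_iff' measurableSet_Ioo).2 ?_
  filter_upwards [(integrable_vol01_iff.1 hf).ae_hasDerivAt_integral] with x hx hx'
  exact (hx (by simpa using Ioo_subset_Icc_self hx') 0 (by simp)).deriv

/-- Integration by parts against an absolutely continuous function. -/
theorem integral_primitive_mul_deriv {f g : ℝ → ℝ} (hf : Integrable f vol01)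
    (hg : AbsolutelyContinuousOnInterval g 0 1) :
    ∫ x, primitive f x * deriv g x ∂vol01
      = primitive f 1 * g 1 - ∫ x, f x * g x ∂vol01 := by
  have h := (absolutelyContinuous_primitive hf).integral_mul_deriv_eq_deriv_mul hg
  rw [← integral_vol01, ← integral_vol01, primitive_zero, zero_mul, sub_zero] at h
  rw [h]
  congr 1
  refine integral_congr_ae ?_
  filter_upwards [deriv_primitive_ae hf] with x hx
  rw [hx]

theorem primitive_congr_ae {f g : ℝ → ℝ} (h : f =ᵐ[vol01] g) {x : ℝ} (hx : x ∈ Icc (0 : ℝ) 1) :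
    primitive f x = primitive g x := by
  unfold primitive
  rw [intervalIntegral.integral_of_le hx.1, intervalIntegral.integral_of_le hx.1,
    integral_Ioc_eq_integral_Ioo, integral_Ioc_eq_integral_Ioo]
  exact integral_congr_ae
    (ae_mono (Measure.restrict_mono (Ioo_subset_Ioo_right hx.2) le_rfl) h)

theorem primitive_congr {f g : ℝ → ℝ} (h : ∀ x ∈ Ioo (0 : ℝ) 1, f x = g x) {x : ℝ}
    (hx : x ∈ Icc (0 : ℝ) 1) : primitive f x = primitive g x :=
  primitive_congr_ae ((ae_restrict_iff' measurableSet_Ioo).2 (Eventually.of_forall h)) hx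

theorem primitive_add {f g : ℝ → ℝ} (hf : Integrable f vol01) (hg : Integrable g vol01) {x : ℝ}
    (hx : x ∈ Icc (0 : ℝ) 1) : primitive (f + g) x = primitive f x + primitive g x :=
  intervalIntegral.integral_add (intervalIntegrable_of_integrable_vol01 hf hx)
    (intervalIntegrable_of_integrable_vol01 hg hx)

theorem primitive_smul (c : ℝ) (f : ℝ → ℝ) (x : ℝ) :
    primitive (c • f) x = c * primitive f x :=
  intervalIntegral.integral_const_mul c f

theorem integrable_of_memLp {f : ℝ → ℝ} (hf : MemLp f 2 vol01) : Integrable f vol01 :=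
  hf.integrable one_le_two

/-- The Cauchy-Schwarz estimate for a primitive. -/
theorem primitive_sq_le {f : ℝ → ℝ} (hf : MemLp f 2 vol01) {x : ℝ} (hx : x ∈ Icc (0 : ℝ) 1) :
    primitive f x ^ 2 ≤ x * ∫ t, f t ^ 2 ∂vol01 := by
  rcases hx.1.eq_or_lt with rfl | hx0
  · simp [primitive_zero]
  have h1 := intervalIntegrable_of_integrable_vol01 (integrable_of_memLp hf) hx
  have h2 := intervalIntegrable_of_integrable_vol01 hf.integrable_sq hx
  have h3 : (∫ t in (0 : ℝ)..x, f t ^ 2) ≤ ∫ t, f t ^ 2 ∂vol01 := by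
    rw [intervalIntegral.integral_of_le hx.1, integral_Ioc_eq_integral_Ioo]
    exact setIntegral_mono_set hf.integrable_sq (Eventually.of_forall fun t => sq_nonneg _)
      (Ioo_subset_Ioo_right hx.2).eventuallyLE
  refine le_trans ?_ (mul_le_mul_of_nonneg_left h3 hx.1)
  -- m is the mean of f over (0, x); expanding ∫ (f - m)² ≥ 0 gives the claim.
  set m := primitive f x / x with hm
  have h4 : 0 ≤ ∫ t in (0 : ℝ)..x, (f t ^ 2 - 2 * m * f t + m ^ 2) :=
    intervalIntegral.integral_nonneg hx.1 fun t _ => by nlinarith [sq_nonneg (f t - m)]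
  rw [intervalIntegral.integral_add (h2.sub (h1.const_mul _)) (by simp),
    intervalIntegral.integral_sub h2 (h1.const_mul _), intervalIntegral.integral_const_mul,
    intervalIntegral.integral_const, smul_eq_mul, sub_zero] at h4
  change 0 ≤ _ - 2 * m * primitive f x + x * m ^ 2 at h4
  have h5 : primitive f x = m * x := by rw [hm]; field_simp
  rw [h5] at h4 ⊢
  nlinarith

theorem memLp_of_continuousOn {f : ℝ → ℝ} (hf : ContinuousOn f (Icc 0 1)) :
    MemLp f 2 vol01 := by
  have hm : AEStronglyMeasurable f vol01 :=
    (integrable_of_continuousOn hf).aestronglyMeasurable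
  refine (memLp_two_iff_integrable_sq hm).2 ?_
  exact integrable_of_continuousOn (hf.pow 2)

/-- The `L²` norm of a primitive. -/
theorem integral_primitive_sq_le {f : ℝ → ℝ} (hf : MemLp f 2 vol01) :
    ∫ x, primitive f x ^ 2 ∂vol01 ≤ (∫ t, f t ^ 2 ∂vol01) / 2 := by
  have h1 : ∫ x, primitive f x ^ 2 ∂vol01 ≤ ∫ x, x * ∫ t, f t ^ 2 ∂vol01 ∂vol01 := by
    refine integral_mono_ae
      (integrable_of_continuousOn ((continuousOn_primitive (integrable_of_memLp hf)).pow 2))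
      (integrable_of_continuousOn (by fun_prop)) ?_
    refine (ae_restrict_iff' measurableSet_Ioo).2 (Eventually.of_forall fun x hx => ?_)
    exact primitive_sq_le hf (Ioo_subset_Icc_self hx)
  rw [integral_mul_const, integral_vol01 (fun x => x), integral_id] at h1
  linarith

/-! ### Weak derivatives of primitives -/

theorem locallyIntegrableOn_of_integrable {f : ℝ → ℝ} (hf : Integrable f vol01) :
    LocallyIntegrableOn f (Ioo 0 1) volume :=
  IntegrableOn.locallyIntegrableOn hf

/-- Integration by parts: a test function vanishes at both endpoints, which removes the boundary
terms and the contribution of c. -/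
theorem isWeakDeriv_of_eq_primitive {u v : Fun01} {c : ℝ} (hv : Integrable v vol01)
    (hu : u =ᵐ[vol01] fun x => c + primitive v x) : IsWeakDeriv u v := by
  have hP := integrable_primitive hv
  have hui : Integrable u vol01 :=
    (((integrable_const c).add hP).congr hu.symm)
  refine ⟨locallyIntegrableOn_of_integrable hui, locallyIntegrableOn_of_integrable hv, ?_⟩
  intro φ h1 h2 h3
  have hφ0 : φ 0 = 0 := image_eq_zero_of_notMem_tsupport fun h => (h3 h).1.false
  have hφ1 : φ 1 = 0 := image_eq_zero_of_notMem_tsupport fun h => (h3 h).2.false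
  have hφ : ContDiff ℝ 1 φ := h1.of_le (by exact_mod_cast le_top)
  have hd : Continuous (deriv φ) := hφ.continuous_deriv le_rfl
  have e1 := integral_primitive_mul_deriv hv hφ.contDiffOn.absolutelyContinuousOnInterval
  have e2 : ∫ x, deriv φ x ∂vol01 = 0 := by
    rw [integral_vol01, intervalIntegral.integral_deriv_eq_sub
      (fun x _ => (hφ.differentiable one_ne_zero) x) (hd.intervalIntegrable _ _), hφ0, hφ1, sub_zero]
  calc ∫ x, u x * deriv φ x ∂vol01
      = ∫ x, (c * deriv φ x + primitive v x * deriv φ x) ∂vol01 := by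
        refine integral_congr_ae ?_
        filter_upwards [hu] with x hx
        rw [hx]; ring
    _ = - ∫ x, v x * φ x ∂vol01 := by
        rw [integral_add, integral_const_mul, e2, e1, hφ1]
        · ring
        · exact integrable_of_continuousOn (by fun_prop)
        · exact integrable_of_continuousOn
            ((continuousOn_primitive hv).mul hd.continuousOn)

/-! ### Test functions and the du Bois-Reymond lemma -/

theorem exists_Icc_of_isCompact {K : Set ℝ} (hK : IsCompact K) (hs : K ⊆ Ioo 0 1) :
    ∃ p q : ℝ, 0 < p ∧ q < 1 ∧ K ⊆ Icc p q := by
  rcases K.eq_empty_or_nonempty with rfl | hne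
  · exact ⟨1, 0, one_pos, zero_lt_one, empty_subset _⟩
  · obtain ⟨p, hp⟩ := hK.exists_isLeast hne
    obtain ⟨q, hq⟩ := hK.exists_isGreatest hne
    exact ⟨p, q, (hs hp.1).1, (hs hq.1).2, fun x hx => ⟨hp.2 hx, hq.2 hx⟩⟩

/-- A test function with vanishing mean is the derivative of a test function. -/
theorem exists_test_antideriv {η : ℝ → ℝ} (h1 : ContDiff ℝ ∞ η) (h2 : HasCompactSupport η)
    (h3 : tsupport η ⊆ Ioo 0 1) (h0 : ∫ x, η x ∂vol01 = 0) :
    ∃ φ : ℝ → ℝ, ContDiff ℝ ∞ φ ∧ HasCompactSupport φ ∧ tsupport φ ⊆ Ioo 0 1 ∧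
      deriv φ = η := by
  obtain ⟨p, q, hp, hq, hK⟩ := exists_Icc_of_isCompact h2 h3
  have hc := h1.continuous
  have hderiv : ∀ x, HasDerivAt (primitive η) (η x) x := fun x =>
    intervalIntegral.integral_hasDerivAt_right (hc.intervalIntegrable _ _)
      (hc.stronglyMeasurableAtFilter _ _) hc.continuousAt
  have hd : deriv (primitive η) = η := funext fun x => (hderiv x).deriv
  have hz : ∀ x, x ∉ Icc p q → η x = 0 := fun x hx =>
    image_eq_zero_of_notMem_tsupport fun h => hx (hK h)
  have hs : ∀ x, x ∉ Icc p q → primitive η x = 0 := by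
    intro x hx
    rcases lt_or_ge x p with hxp | hxp
    · refine intervalIntegral.integral_zero_ae (Eventually.of_forall fun t ht => hz t fun h => ?_)
      exact absurd ht.2 (not_le.2 (lt_of_lt_of_le (max_lt hp hxp) h.1))
    -- To the right of the support the primitive keeps its value at 1, which is the vanishing mean.
    · have hxq : q < x := not_le.1 fun h => hx ⟨hxp, h⟩
      have e : primitive η 1 + ∫ t in (1 : ℝ)..x, η t = primitive η x :=
        intervalIntegral.integral_add_adjacent_intervals (hc.intervalIntegrable _ _)
          (hc.intervalIntegrable _ _)
      rw [← e, ← integral_vol01_eq_primitive, h0, zero_add]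
      refine intervalIntegral.integral_zero_ae (Eventually.of_forall fun t ht => hz t fun h => ?_)
      exact absurd ht.1 (not_lt.2 (h.2.trans (lt_min hq hxq).le))
  have hsub : Function.support (primitive η) ⊆ Icc p q := fun x hx => by
    by_contra h
    exact hx (hs x h)
  refine ⟨primitive η, ?_, HasCompactSupport.of_support_subset_isCompact isCompact_Icc hsub, ?_, hd⟩
  · exact contDiff_infty_iff_deriv.2 ⟨fun x => (hderiv x).differentiableAt, by rwa [hd]⟩
  · exact (closure_minimal hsub isClosed_Icc).trans fun x hx =>
      ⟨hp.trans_le hx.1, hx.2.trans_lt hq⟩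

theorem integrable_mul_test {f φ : ℝ → ℝ} (hf : LocallyIntegrableOn f (Ioo 0 1) volume)
    (h1 : Continuous φ) (h2 : HasCompactSupport φ) (h3 : tsupport φ ⊆ Ioo 0 1) :
    Integrable (fun x => f x * φ x) vol01 := by
  have : IntegrableOn (fun x => f x * φ x) (tsupport φ) volume :=
    (hf.integrableOn_compact_subset h3 h2).mul_continuousOn h1.continuousOn h2
  refine Integrable.restrict ((integrableOn_iff_integrable_of_support_subset ?_).1 this)
  intro x hx
  refine subset_tsupport _ fun h0 => hx ?_
  simp [h0]

/-- The du Bois-Reymond lemma. -/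
theorem ae_eq_const_of_integral_mul_deriv_eq_zero {u : ℝ → ℝ}
    (hu : LocallyIntegrableOn u (Ioo 0 1) volume)
    (h : ∀ φ : ℝ → ℝ, ContDiff ℝ ∞ φ → HasCompactSupport φ → tsupport φ ⊆ Ioo 0 1 →
      ∫ x, u x * deriv φ x ∂vol01 = 0) : ∃ c : ℝ, u =ᵐ[vol01] fun _ => c := by
  -- A fixed bump ρ of mass one turns any test function ψ into one of mean zero, ψ - (∫ψ)ρ, which is
  -- a derivative. The constant must therefore be ∫ uρ.
  let b : ContDiffBump (1 / 2 : ℝ) := ⟨1 / 8, 1 / 4, by norm_num, by norm_num⟩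
  set ρ : ℝ → ℝ := b.normed volume with hρ
  have r1 : ContDiff ℝ ∞ ρ := b.contDiff_normed
  have r2 : HasCompactSupport ρ := b.hasCompactSupport_normed
  have r3 : tsupport ρ ⊆ Ioo 0 1 := by
    rw [hρ, b.tsupport_normed_eq, Real.closedBall_eq_Icc]
    intro x hx
    have h1 : (1 / 2 - 1 / 4 : ℝ) ≤ x := hx.1
    have h2 : x ≤ (1 / 2 + 1 / 4 : ℝ) := hx.2
    constructor <;> linarith
  have r4 : ∫ x, ρ x ∂vol01 = 1 := by
    rw [setIntegral_eq_integral_of_forall_compl_eq_zero, b.integral_normed]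
    exact fun x hx => image_eq_zero_of_notMem_tsupport fun h' => hx (r3 h')
  refine ⟨∫ x, u x * ρ x ∂vol01, ?_⟩
  set c := ∫ x, u x * ρ x ∂vol01
  have hcl : LocallyIntegrableOn (fun _ : ℝ => c) (Ioo 0 1) volume :=
    (continuous_const.locallyIntegrable).locallyIntegrableOn _
  have key : ∀ᵐ x ∂(volume : Measure ℝ), x ∈ Ioo (0 : ℝ) 1 → u x - c = 0 := by
    refine isOpen_Ioo.ae_eq_zero_of_integral_contDiff_smul_eq_zero (hu.sub hcl) ?_
    intro ψ p1 p2 p3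
    have pint : Integrable ψ vol01 := integrable_of_continuousOn p1.continuous.continuousOn
    have rint : Integrable ρ vol01 := integrable_of_continuousOn r1.continuous.continuousOn
    set m := ∫ x, ψ x ∂vol01 with hm
    have hsupp : tsupport (fun x => ψ x - m * ρ x) ⊆ tsupport ψ ∪ tsupport ρ := by
      refine closure_minimal ?_ ((isClosed_tsupport _).union (isClosed_tsupport _))
      intro x hx
      by_contra hcon
      rw [mem_union, not_or] at hcon
      refine hx ?_
      simp [image_eq_zero_of_notMem_tsupport hcon.1, image_eq_zero_of_notMem_tsupport hcon.2]
    obtain ⟨φ, f1, f2, f3, f4⟩ := exists_test_antideriv (η := fun x => ψ x - m * ρ x)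
      (p1.sub (contDiff_const.mul r1))
      ((IsCompact.union p2 r2).of_isClosed_subset (isClosed_tsupport _) hsupp)
      (hsupp.trans (union_subset p3 r3))
      (by rw [integral_sub pint (rint.const_mul m), integral_const_mul, r4, hm]; ring)
    have e := h φ f1 f2 f3
    rw [f4] at e
    have i1 := integrable_mul_test hu p1.continuous p2 p3
    have i2 := integrable_mul_test hu r1.continuous r2 r3
    have e1 : ∫ x, u x * (ψ x - m * ρ x) ∂vol01 = (∫ x, u x * ψ x ∂vol01) - m * c := by
      rw [← integral_const_mul, ← integral_sub i1 (i2.const_mul m)]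
      congr 1; funext x; ring
    rw [e1] at e
    have e2 : ∫ x, ψ x • (u x - c) ∂vol01 = (∫ x, u x * ψ x ∂vol01) - m * c := by
      rw [hm, mul_comm, ← integral_const_mul, ← integral_sub i1 (pint.const_mul c)]
      congr 1; funext x; simp only [smul_eq_mul]; ring
    rw [← setIntegral_eq_integral_of_forall_compl_eq_zero (s := Ioo (0 : ℝ) 1), e2, e]
    intro x hx
    have : ψ x = 0 := image_eq_zero_of_notMem_tsupport fun h' => hx (p3 h')
    simp [this]
  refine (ae_restrict_iff' measurableSet_Ioo).2 ?_
  filter_upwards [key] with x hx hx'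
  linarith [hx hx']

/-- The difference of u and the primitive of v annihilates all derivatives of test functions, so du
Bois-Reymond applies. -/
theorem IsWeakDeriv.exists_eq_primitive {u v : Fun01} (h : IsWeakDeriv u v)
    (hv : Integrable v vol01) : ∃ c : ℝ, u =ᵐ[vol01] fun x => c + primitive v x := by
  have hP := integrable_primitive hv
  have hPl := locallyIntegrableOn_of_integrable hP
  obtain ⟨c, hc⟩ := ae_eq_const_of_integral_mul_deriv_eq_zero (h.1.sub hPl) (by
    intro φ h1 h2 h3
    have hφ1 : φ 1 = 0 := image_eq_zero_of_notMem_tsupport fun h => (h3 h).2.false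
    have hφ : ContDiff ℝ 1 φ := h1.of_le (by exact_mod_cast le_top)
    have hd : Continuous (deriv φ) := hφ.continuous_deriv le_rfl
    have d3 : tsupport (deriv φ) ⊆ Ioo 0 1 := (tsupport_deriv_subset (𝕜 := ℝ)).trans h3
    have e1 := integral_primitive_mul_deriv hv hφ.contDiffOn.absolutelyContinuousOnInterval
    have e2 := h.2.2 φ h1 h2 h3
    rw [hφ1, mul_zero, zero_sub] at e1
    have : ∫ x, (u x * deriv φ x - primitive v x * deriv φ x) ∂vol01 = 0 := by
      rw [integral_sub (integrable_mul_test h.1 hd h2.deriv d3)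
        (integrable_mul_test hPl hd h2.deriv d3), e1, e2, sub_self]
    rw [← this]
    congr 1; funext x; simp only [Pi.sub_apply]; ring)
  refine ⟨c, ?_⟩
  filter_upwards [hc] with x hx
  simp only [Pi.sub_apply] at hx
  linarith

/-! ### Evaluating the chosen weak derivatives and point values -/

theorem weakDeriv_eq {u v : Fun01} (h : IsWeakDeriv u v) : weakDeriv u = v := by
  have hex : WeaklyDiff u := ⟨v, h⟩
  rw [weakDeriv, dif_pos hex]
  exact hex.choose_spec.unique h

theorem WeaklyDiff.isWeakDeriv {u : Fun01} (h : WeaklyDiff u) : IsWeakDeriv u (weakDeriv u) := by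
  rw [weakDeriv, dif_pos h]
  exact h.choose_spec

theorem HasValueAt.valueAt_eq {u : Fun01} {x c : ℝ} (hx : x ∈ Icc (0 : ℝ) 1)
    (h : HasValueAt u x c) : valueAt u x = c := by
  have hex : ∃ c, HasValueAt u x c := ⟨c, h⟩
  rw [valueAt, dif_pos hex]
  exact hex.choose_spec.unique hx h

theorem hasValueAt_of_continuousOn {u : Fun01} {g : ℝ → ℝ} (h : u =ᵐ[vol01] g)
    (hg : ContinuousOn g (Icc 0 1)) {x : ℝ} (hx : x ∈ Icc (0 : ℝ) 1) : HasValueAt u x (g x) :=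
  ⟨g, h, hg x hx, rfl⟩

theorem valueAt_eq_of_continuousOn {u : Fun01} {g : ℝ → ℝ} (h : u =ᵐ[vol01] g)
    (hg : ContinuousOn g (Icc 0 1)) {x : ℝ} (hx : x ∈ Icc (0 : ℝ) 1) : valueAt u x = g x :=
  (hasValueAt_of_continuousOn h hg hx).valueAt_eq hx

/-! ### The weight -/

/-- Lower bound for a function whose logarithmic derivative is at most `K / x`. -/
theorem mul_rpow_le_of_deriv_le {a : ℝ → ℝ} {K : ℝ} (hc : ContinuousOn a (Ioc 0 1))
    (hd : DifferentiableOn ℝ a (Ioo 0 1)) (h : ∀ x ∈ Ioo (0 : ℝ) 1, x * deriv a x ≤ K * a x)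
    {x : ℝ} (hx : x ∈ Ioc (0 : ℝ) 1) : a 1 * x ^ K ≤ a x := by
  -- The derivative is x^(-K-1) (x a' - K a) ≤ 0; comparison with the value at 1 then gives the
  -- bound.
  have hanti : AntitoneOn (fun x => a x * x ^ (-K)) (Ioc 0 1) := by
    have hda : ∀ y ∈ Ioo (0 : ℝ) 1, HasDerivAt (fun x => a x * x ^ (-K))
        (deriv a y * y ^ (-K) + a y * (-K * y ^ (-K - 1))) y := fun y hy =>
      ((hd y hy).differentiableAt (isOpen_Ioo.mem_nhds hy)).hasDerivAt.mul
        (Real.hasDerivAt_rpow_const (Or.inl hy.1.ne'))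
    refine antitoneOn_of_deriv_nonpos (convex_Ioc 0 1)
      (hc.mul (continuousOn_id.rpow_const fun y hy => Or.inl hy.1.ne')) ?_ ?_
    · rw [interior_Ioc]
      exact fun y hy => (hda y hy).differentiableAt.differentiableWithinAt
    · rw [interior_Ioc]
      intro y hy
      rw [(hda y hy).deriv]
      have e : y ^ (-K) = y * y ^ (-K - 1) := by
        rw [Real.rpow_sub_one hy.1.ne']; field_simp [hy.1.ne']
      have hp := Real.rpow_pos_of_pos hy.1 (-K - 1)
      rw [e]
      nlinarith [h y hy]
  have h1 := hanti hx (right_mem_Ioc.2 one_pos) hx.2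
  simp only [Real.one_rpow, mul_one] at h1
  have hp := Real.rpow_pos_of_pos hx.1 K
  calc a 1 * x ^ K ≤ a x * x ^ (-K) * x ^ K := mul_le_mul_of_nonneg_right h1 hp.le
    _ = a x := by
      rw [mul_assoc, ← Real.rpow_add hx.1, neg_add_cancel, Real.rpow_zero, mul_one]

/-- What the degeneracy conditions give: `a` is continuous, positive, and bounded below by a
multiple of a power of `x` with exponent less than `2`. -/
structure IsWeight (a : ℝ → ℝ) : Prop where
  continuousOn : ContinuousOn a (Ioc 0 1)
  pos : ∀ x ∈ Ioc (0 : ℝ) 1, 0 < a x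
  lower : ∃ K < (2 : ℝ), ∀ x ∈ Ioc (0 : ℝ) 1, a 1 * x ^ K ≤ a x

theorem isWeight_of_isLUB {a : ℝ → ℝ} {K : ℝ} (hc : ContDiffOn ℝ 1 a (Ioc 0 1))
    (hpos : ∀ x ∈ Ioc (0 : ℝ) 1, 0 < a x) (hK : K < 2) (hlub : IsLUB (degeneracyRatios a) K) :
    IsWeight a := by
  refine ⟨hc.continuousOn, hpos, K, hK, fun x hx => ?_⟩
  refine mul_rpow_le_of_deriv_le hc.continuousOn
    ((hc.differentiableOn one_ne_zero).mono Ioo_subset_Ioc_self) (fun y hy => ?_) hx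
  have h := hlub.1 (mem_image_of_mem _ (Ioo_subset_Ioc_self hy))
  rw [derivWithin_of_mem_nhds (Icc_mem_nhds hy.1 hy.2),
    div_le_iff₀ (hpos y (Ioo_subset_Ioc_self hy))] at h
  exact (mul_le_mul_of_nonneg_left (le_abs_self _) hy.1.le).trans h

theorem isWeight_of_isWD_or_isSD {a : ℝ → ℝ} (ha : IsWD a ∨ IsSD a) : IsWeight a := by
  rcases ha with ha | ha
  · obtain ⟨K, hK, hl⟩ := ha.sup_mem
    exact isWeight_of_isLUB ha.contDiffOn ha.pos (hK.2.trans one_lt_two) hl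
  · obtain ⟨K, hK, hl⟩ := ha.sup_mem
    exact isWeight_of_isLUB (ha.contDiffOn.mono Ioc_subset_Icc_self) ha.pos hK.2 hl

theorem IsWeight.aestronglyMeasurable_div {a f : ℝ → ℝ} (ha : IsWeight a)
    (hf : ContinuousOn f (Icc 0 1)) : AEStronglyMeasurable (fun x => f x / a x) vol01 :=
  ((hf.mono Ioo_subset_Icc_self).div (ha.continuousOn.mono Ioo_subset_Ioc_self)
    fun x hx => (ha.pos x (Ioo_subset_Ioc_self hx)).ne').aestronglyMeasurable measurableSet_Ioo

/-- This is where K < 2 is needed: x/a is dominated by x^(1-K)/a(1), whose exponent exceeds -1. -/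
theorem IsWeight.integrable_id_div {a : ℝ → ℝ} (ha : IsWeight a) :
    Integrable (fun x => x / a x) vol01 := by
  obtain ⟨K, hK, hl⟩ := ha.lower
  have h1 := ha.pos 1 (right_mem_Ioc.2 one_pos)
  have hint : Integrable (fun x : ℝ => (a 1)⁻¹ * x ^ (1 - K)) vol01 :=
    (integrable_vol01_iff.2 (intervalIntegral.intervalIntegrable_rpow' (by linarith))).const_mul _
  refine hint.mono' (ha.aestronglyMeasurable_div continuousOn_id) ?_
  refine (ae_restrict_iff' measurableSet_Ioo).2 (Eventually.of_forall fun x hx => ?_)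
  have hp := Real.rpow_pos_of_pos hx.1 K
  have hx' := Ioo_subset_Ioc_self hx
  rw [Real.norm_of_nonneg (div_nonneg hx.1.le (ha.pos x hx').le),
    div_le_iff₀ (ha.pos x hx'), Real.rpow_sub hx.1, Real.rpow_one]
  calc x = (a 1)⁻¹ * (x / x ^ K) * (a 1 * x ^ K) := by field_simp
    _ ≤ (a 1)⁻¹ * (x / x ^ K) * a x :=
      mul_le_mul_of_nonneg_left (hl x hx') (by have := hx.1; positivity)

theorem IsWeight.primitive_sq_div_le {a v : ℝ → ℝ} (ha : IsWeight a) (hv : MemLp v 2 vol01)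
    {x : ℝ} (hx : x ∈ Ioo (0 : ℝ) 1) :
    primitive v x ^ 2 / a x ≤ (∫ t, v t ^ 2 ∂vol01) * (x / a x) := by
  have hp := ha.pos x (Ioo_subset_Ioc_self hx)
  rw [← mul_div_assoc, div_le_div_iff_of_pos_right hp, mul_comm]
  exact primitive_sq_le hv (Ioo_subset_Icc_self hx)

theorem IsWeight.integrable_primitive_sq_div {a v : ℝ → ℝ} (ha : IsWeight a)
    (hv : MemLp v 2 vol01) : Integrable (fun x => primitive v x ^ 2 / a x) vol01 := by
  refine (ha.integrable_id_div.const_mul (∫ t, v t ^ 2 ∂vol01)).mono'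
    (ha.aestronglyMeasurable_div ((continuousOn_primitive (integrable_of_memLp hv)).pow 2)) ?_
  refine (ae_restrict_iff' measurableSet_Ioo).2 (Eventually.of_forall fun x hx => ?_)
  rw [Real.norm_of_nonneg
    (div_nonneg (sq_nonneg _) (ha.pos x (Ioo_subset_Ioc_self hx)).le)]
  exact ha.primitive_sq_div_le hv hx

/-- The Hardy-Poincaré inequality, with a non-optimal constant. -/
theorem IsWeight.integral_primitive_sq_div_le {a v : ℝ → ℝ} (ha : IsWeight a)
    (hv : MemLp v 2 vol01) :
    ∫ x, primitive v x ^ 2 / a x ∂vol01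
      ≤ (∫ x, x / a x ∂vol01) * ∫ t, v t ^ 2 ∂vol01 := by
  rw [mul_comm, ← integral_const_mul]
  refine integral_mono_ae (ha.integrable_primitive_sq_div hv)
    (ha.integrable_id_div.const_mul _) ?_
  exact (ae_restrict_iff' measurableSet_Ioo).2
    (Eventually.of_forall fun x hx => ha.primitive_sq_div_le hv hx)

/-! ### Description of the spaces through primitives -/

theorem weakDeriv_of_ae_eq_primitive {u : Fun01} {v : ℝ → ℝ} {c : ℝ} (hv : Integrable v vol01)
    (hu : u =ᵐ[vol01] fun x => c + primitive v x) :
    WeaklyDiff u ∧ weakDeriv u =ᵐ[vol01] v := by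
  let V : Fun01 := AEEqFun.mk v hv.aestronglyMeasurable
  have hV : V =ᵐ[vol01] v := AEEqFun.coeFn_mk _ _
  have h : IsWeakDeriv u V := by
    refine isWeakDeriv_of_eq_primitive (c := c) (hv.congr hV.symm) (hu.trans ?_)
    refine (ae_restrict_iff' measurableSet_Ioo).2 (Eventually.of_forall fun x hx => ?_)
    dsimp only
    rw [primitive_congr_ae hV (Ioo_subset_Icc_self hx)]
  exact ⟨⟨V, h⟩, by rw [weakDeriv_eq h]; exact hV⟩

/-- The free constant of integration is the value at 0 of the continuous representative. -/
theorem ae_eq_primitive_of_valueAt_zero {u : Fun01} (h : WeaklyDiff u)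
    (hv : MemLp (weakDeriv u) 2 vol01) (h0 : valueAt u 0 = 0) :
    u =ᵐ[vol01] primitive (weakDeriv u) := by
  have hi := integrable_of_memLp hv
  obtain ⟨c, hc⟩ := h.isWeakDeriv.exists_eq_primitive hi
  have := valueAt_eq_of_continuousOn hc (continuousOn_const.add (continuousOn_primitive hi))
    (left_mem_Icc.2 zero_le_one)
  rw [h0, primitive_zero, add_zero] at this
  simpa [← this] using hc

theorem H1a0_ae_eq {a : ℝ → ℝ} {u : Fun01} (hu : u ∈ H1a0 a) :
    MemLp (D 1 u) 2 vol01 ∧ u =ᵐ[vol01] primitive (D 1 u) := by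
  have h1 := hu.2.1.2 1 le_rfl
  exact ⟨h1, ae_eq_primitive_of_valueAt_zero (hu.2.1.1 0 one_pos) h1 hu.2.2⟩

/-- Converse of `H1a0_ae_eq`: the weighted integrability comes for free from that of x/a. -/
theorem IsWeight.mem_H1a0 {a : ℝ → ℝ} (ha : IsWeight a) {u : Fun01} {v : ℝ → ℝ}
    (hv : MemLp v 2 vol01) (hu : u =ᵐ[vol01] primitive v) :
    u ∈ H1a0 a ∧ D 1 u =ᵐ[vol01] v := by
  have hi := integrable_of_memLp hv
  obtain ⟨h1, h2⟩ := weakDeriv_of_ae_eq_primitive (c := 0) hi (by simpa using hu)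
  have hu2 : MemLp u 2 vol01 := (memLp_of_continuousOn (continuousOn_primitive hi)).ae_eq hu.symm
  refine ⟨⟨⟨hu2, ?_⟩, ⟨?_, ?_⟩, ?_⟩, h2⟩
  · refine (ha.integrable_primitive_sq_div hv).congr ?_
    filter_upwards [hu] with x hx
    rw [hx]
  · intro i hi
    obtain rfl : i = 0 := by omega
    exact h1
  · intro i hi
    interval_cases i
    · exact hu2
    · exact hv.ae_eq h2.symm
  · rw [valueAt_eq_of_continuousOn hu (continuousOn_primitive hi) (left_mem_Icc.2 zero_le_one),
      primitive_zero]

/-- `u` is the function with second derivative `w ∈ L²(0,1)` that vanishes to first order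
at `0`. -/
def IsBending (u : Fun01) (w : ℝ → ℝ) : Prop :=
  MemLp w 2 vol01 ∧ u =ᵐ[vol01] primitive (primitive w)

/-- The conditions u(0) = 0 and u'(0) = 0 each remove one constant of integration. -/
theorem isBending_of_mem {a : ℝ → ℝ} {u : Fun01} (hu : u ∈ H2a0 a) : IsBending u (D 2 u) := by
  obtain ⟨h1, h2⟩ := H1a0_ae_eq hu.1
  have h3 := hu.2.1.2 2 le_rfl
  refine ⟨h3, h2.trans ?_⟩
  have h4 := ae_eq_primitive_of_valueAt_zero (hu.2.1.1 1 one_lt_two) h3 hu.2.2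
  exact (ae_restrict_iff' measurableSet_Ioo).2
    (Eventually.of_forall fun x hx => primitive_congr_ae h4 (Ioo_subset_Icc_self hx))

namespace IsBending

variable {u v : Fun01} {w w' : ℝ → ℝ}

theorem integrable (h : IsBending u w) : Integrable w vol01 := integrable_of_memLp h.1

theorem memLp_primitive (h : IsBending u w) : MemLp (primitive w) 2 vol01 :=
  memLp_of_continuousOn (continuousOn_primitive h.integrable)

theorem weakDeriv (h : IsBending u w) : WeaklyDiff u ∧ D 1 u =ᵐ[vol01] primitive w :=
  weakDeriv_of_ae_eq_primitive (c := 0) (integrable_primitive h.integrable) (by simpa using h.2)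

theorem weakDeriv_two (h : IsBending u w) : WeaklyDiff (D 1 u) ∧ D 2 u =ᵐ[vol01] w :=
  weakDeriv_of_ae_eq_primitive (c := 0) h.integrable (by simpa using h.weakDeriv.2)

theorem valueAt_eq (h : IsBending u w) : valueAt u 1 = primitive (primitive w) 1 :=
  valueAt_eq_of_continuousOn h.2 (continuousOn_primitive (integrable_primitive h.integrable))
    (right_mem_Icc.2 zero_le_one)

theorem valueAt_D_eq (h : IsBending u w) : valueAt (D 1 u) 1 = primitive w 1 :=
  valueAt_eq_of_continuousOn h.weakDeriv.2 (continuousOn_primitive h.integrable)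
    (right_mem_Icc.2 zero_le_one)

/-- Together with `isBending_of_mem` this shows that the space is the same for every admissible
weight. -/
theorem mem_H2a0 {a : ℝ → ℝ} (ha : IsWeight a) (h : IsBending u w) : u ∈ H2a0 a := by
  have h1 := (ha.mem_H1a0 h.memLp_primitive h.2).1
  refine ⟨h1, ⟨?_, ?_⟩, ?_⟩
  · intro i hi
    interval_cases i
    · exact h.weakDeriv.1
    · exact h.weakDeriv_two.1
  · intro i hi
    interval_cases i
    · exact h1.1.1
    · exact h.memLp_primitive.ae_eq h.weakDeriv.2.symm
    · exact h.1.ae_eq h.weakDeriv_two.2.symm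
  · rw [valueAt_eq_of_continuousOn h.weakDeriv.2 (continuousOn_primitive h.integrable)
      (left_mem_Icc.2 zero_le_one), primitive_zero]

theorem add (hu : IsBending u w) (hv : IsBending v w') : IsBending (u + v) (w + w') := by
  refine ⟨hu.1.add hv.1, ?_⟩
  filter_upwards [AEEqFun.coeFn_add u v, hu.2, hv.2, ae_restrict_mem measurableSet_Ioo]
    with x h1 h2 h3 hx
  have hx' := Ioo_subset_Icc_self hx
  rw [h1, Pi.add_apply, h2, h3, ← primitive_add (integrable_primitive hu.integrable)
    (integrable_primitive hv.integrable) hx']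
  exact primitive_congr (fun y hy =>
    (primitive_add hu.integrable hv.integrable (Ioo_subset_Icc_self hy)).symm) hx'

theorem smul (c : ℝ) (hu : IsBending u w) : IsBending (c • u) (c • w) := by
  refine ⟨hu.1.const_smul c, ?_⟩
  filter_upwards [AEEqFun.coeFn_smul c u, hu.2] with x h1 h2
  rw [h1, Pi.smul_apply, h2, smul_eq_mul, ← primitive_smul]
  congr 1
  funext y
  exact (primitive_smul c w y).symm

theorem zero : IsBending 0 0 := by
  refine ⟨MemLp.zero, ?_⟩
  filter_upwards [AEEqFun.coeFn_zero (α := ℝ) (μ := vol01) (β := ℝ)] with x hx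
  rw [hx]
  simp [primitive]

theorem eq_zero (hu : IsBending u w) (h : ∫ x, w x ^ 2 ∂vol01 = 0) : u = 0 := by
  have h1 : w =ᵐ[vol01] 0 := by
    filter_upwards [(integral_eq_zero_iff_of_nonneg (fun x => sq_nonneg (w x))
      hu.1.integrable_sq).1 h] with x hx
    simpa using hx
  refine AEEqFun.ext (hu.2.trans ?_)
  filter_upwards [AEEqFun.coeFn_zero (α := ℝ) (μ := vol01) (β := ℝ),
    ae_restrict_mem measurableSet_Ioo] with x hx hx'
  rw [hx, primitive_congr (fun y hy => primitive_congr_ae h1 (Ioo_subset_Icc_self hy))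
    (Ioo_subset_Icc_self hx')]
  simp [primitive]

theorem valueAt_sq_le (hu : IsBending u w) : valueAt u 1 ^ 2 ≤ ∫ x, w x ^ 2 ∂vol01 := by
  rw [hu.valueAt_eq]
  have h1 := primitive_sq_le hu.memLp_primitive (right_mem_Icc.2 zero_le_one)
  have h2 := integral_primitive_sq_le hu.1
  have h3 : 0 ≤ ∫ x, w x ^ 2 ∂vol01 := integral_nonneg fun x => sq_nonneg _
  linarith

theorem valueAt_D_sq_le (hu : IsBending u w) :
    valueAt (D 1 u) 1 ^ 2 ≤ ∫ x, w x ^ 2 ∂vol01 := by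
  rw [hu.valueAt_D_eq]
  have h1 := primitive_sq_le hu.1 (right_mem_Icc.2 zero_le_one)
  linarith

/-- The pairing of an affine function with the second derivative. -/
theorem integral_affine_mul (hu : IsBending u w) (r s : ℝ) :
    ∫ x, (r + s * x) * w x ∂vol01
      = (r + s) * valueAt (D 1 u) 1 - s * valueAt u 1 := by
  -- The factor integrated is w, with primitive u'; the remaining integral of s u' is s u(1), since
  -- u(0) = 0.
  have h1 := integral_primitive_mul_deriv hu.integrable (g := fun x => r + s * x)
    (ContDiffOn.absolutelyContinuousOnInterval (by fun_prop))
  have h2 : deriv (fun x : ℝ => r + s * x) = fun _ => s := by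
    funext x
    simp
  rw [h2, integral_mul_const, integral_vol01_eq_primitive] at h1
  rw [hu.valueAt_eq, hu.valueAt_D_eq]
  simp only [mul_comm _ (w _)]
  linarith

end IsBending

/-! ### The energy form -/

/-- The bilinear form of the variational problem. -/
noncomputable def energyForm (β γ : ℝ) (u v : Fun01) : ℝ :=
  (∫ x, (D 2 u) x * (D 2 v) x ∂vol01) + β * valueAt u 1 * valueAt v 1
    + γ * valueAt (D 1 u) 1 * valueAt (D 1 v) 1

theorem energyForm_comm (β γ : ℝ) (u v : Fun01) : energyForm β γ u v = energyForm β γ v u := by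
  unfold energyForm
  simp only [mul_comm ((D 2 u) _)]
  ring

theorem energyForm_self (β γ : ℝ) (u : Fun01) :
    energyForm β γ u u
      = (∫ x, (D 2 u) x ^ 2 ∂vol01) + β * valueAt u 1 ^ 2 + γ * valueAt (D 1 u) 1 ^ 2 := by
  unfold energyForm
  simp only [← pow_two]
  ring

theorem energyNorm_eq_sqrt (β γ : ℝ) (u : Fun01) :
    energyNorm β γ u = √(energyForm β γ u u) := by
  rw [energyForm_self, energyNorm]

theorem integral_D_two_sq_nonneg (u : Fun01) : 0 ≤ ∫ x, (D 2 u) x ^ 2 ∂vol01 :=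
  integral_nonneg fun _ => sq_nonneg _

theorem integral_D_two_sq_le_energyForm {β γ : ℝ} (hβ : 0 ≤ β) (hγ : 0 ≤ γ) (u : Fun01) :
    ∫ x, (D 2 u) x ^ 2 ∂vol01 ≤ energyForm β γ u u := by
  rw [energyForm_self]
  have := mul_nonneg hβ (sq_nonneg (valueAt u 1))
  have := mul_nonneg hγ (sq_nonneg (valueAt (D 1 u) 1))
  linarith

theorem energyForm_self_nonneg {β γ : ℝ} (hβ : 0 ≤ β) (hγ : 0 ≤ γ) (u : Fun01) :
    0 ≤ energyForm β γ u u :=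
  (integral_D_two_sq_nonneg u).trans (integral_D_two_sq_le_energyForm hβ hγ u)

theorem energyNorm_sq {β γ : ℝ} (hβ : 0 ≤ β) (hγ : 0 ≤ γ) (u : Fun01) :
    energyNorm β γ u ^ 2 = energyForm β γ u u := by
  rw [energyNorm_eq_sqrt, Real.sq_sqrt (energyForm_self_nonneg hβ hγ u)]

/-- Lets one proof of the norm axioms serve both norms. -/
theorem normD2_eq_energyNorm : normD2 = energyNorm 0 0 := by
  funext u
  simp [normD2, energyNorm]

/-- The values of the energy form in terms of second derivatives. -/
theorem IsBending.energyForm_eq {u v : Fun01} {w w' : ℝ → ℝ} (hu : IsBending u w)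
    (hv : IsBending v w') (β γ : ℝ) :
    energyForm β γ u v = (∫ x, w x * w' x ∂vol01)
      + β * primitive (primitive w) 1 * primitive (primitive w') 1
      + γ * primitive w 1 * primitive w' 1 := by
  have hi : ∫ x, (D 2 u) x * (D 2 v) x ∂vol01 = ∫ x, w x * w' x ∂vol01 := by
    refine integral_congr_ae ?_
    filter_upwards [hu.weakDeriv_two.2, hv.weakDeriv_two.2] with x h1 h2
    rw [h1, h2]
  rw [energyForm, hu.valueAt_eq, hv.valueAt_eq, hu.valueAt_D_eq, hv.valueAt_D_eq, hi]

section Linear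

variable {a : ℝ → ℝ} {u v : Fun01}

theorem zero_mem_H2a0 (ha : IsWeight a) : (0 : Fun01) ∈ H2a0 a := IsBending.zero.mem_H2a0 ha

theorem add_mem_H2a0 (ha : IsWeight a) (hu : u ∈ H2a0 a) (hv : v ∈ H2a0 a) : u + v ∈ H2a0 a :=
  ((isBending_of_mem hu).add (isBending_of_mem hv)).mem_H2a0 ha

theorem smul_mem_H2a0 (ha : IsWeight a) (c : ℝ) (hu : u ∈ H2a0 a) : c • u ∈ H2a0 a :=
  ((isBending_of_mem hu).smul c).mem_H2a0 ha

theorem valueAt_add_of_mem (hu : u ∈ H2a0 a) (hv : v ∈ H2a0 a) :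
    valueAt (u + v) 1 = valueAt u 1 + valueAt v 1 ∧
      valueAt (D 1 (u + v)) 1 = valueAt (D 1 u) 1 + valueAt (D 1 v) 1 := by
  have hu' := isBending_of_mem hu
  have hv' := isBending_of_mem hv
  have h := hu'.add hv'
  have h1 : (1 : ℝ) ∈ Icc (0 : ℝ) 1 := right_mem_Icc.2 zero_le_one
  rw [h.valueAt_eq, h.valueAt_D_eq, hu'.valueAt_eq, hv'.valueAt_eq, hu'.valueAt_D_eq,
    hv'.valueAt_D_eq, ← primitive_add hu'.integrable hv'.integrable h1,
    ← primitive_add (integrable_primitive hu'.integrable) (integrable_primitive hv'.integrable) h1]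
  exact ⟨primitive_congr (fun y hy =>
    primitive_add hu'.integrable hv'.integrable (Ioo_subset_Icc_self hy)) h1, rfl⟩

theorem valueAt_smul_of_mem (c : ℝ) (hu : u ∈ H2a0 a) :
    valueAt (c • u) 1 = c * valueAt u 1 ∧
      valueAt (D 1 (c • u)) 1 = c * valueAt (D 1 u) 1 := by
  have hu' := isBending_of_mem hu
  have h := hu'.smul c
  rw [h.valueAt_eq, h.valueAt_D_eq, hu'.valueAt_eq, hu'.valueAt_D_eq, ← primitive_smul,
    ← primitive_smul]
  refine ⟨?_, rfl⟩
  congr 1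
  funext y
  exact primitive_smul c _ y

theorem energyForm_add_left {φ : Fun01} (β γ : ℝ) (hu : u ∈ H2a0 a) (hv : v ∈ H2a0 a)
    (hφ : φ ∈ H2a0 a) :
    energyForm β γ (u + v) φ = energyForm β γ u φ + energyForm β γ v φ := by
  have hu' := isBending_of_mem hu
  have hv' := isBending_of_mem hv
  have hφ' := isBending_of_mem hφ
  have hi : ∫ x, (D 2 (u + v)) x * (D 2 φ) x ∂vol01
      = (∫ x, (D 2 u) x * (D 2 φ) x ∂vol01) + ∫ x, (D 2 v) x * (D 2 φ) x ∂vol01 := by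
    refine Eq.trans (integral_congr_ae ?_)
      (integral_add (hu'.1.integrable_mul hφ'.1) (hv'.1.integrable_mul hφ'.1))
    filter_upwards [(hu'.add hv').weakDeriv_two.2] with x hx
    rw [hx, Pi.add_apply, add_mul]
  simp only [energyForm, hi, (valueAt_add_of_mem hu hv).1, (valueAt_add_of_mem hu hv).2]
  ring

theorem energyForm_smul_left {φ : Fun01} (β γ c : ℝ) (hu : u ∈ H2a0 a) :
    energyForm β γ (c • u) φ = c * energyForm β γ u φ := by
  have hi : ∫ x, (D 2 (c • u)) x * (D 2 φ) x ∂vol01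
      = c * ∫ x, (D 2 u) x * (D 2 φ) x ∂vol01 := by
    rw [← integral_const_mul]
    refine integral_congr_ae ?_
    filter_upwards [((isBending_of_mem hu).smul c).weakDeriv_two.2] with x hx
    rw [hx, Pi.smul_apply, smul_eq_mul, mul_assoc]
  simp only [energyForm, hi, (valueAt_smul_of_mem c hu).1, (valueAt_smul_of_mem c hu).2]
  ring

theorem energyForm_add_self (ha : IsWeight a) (β γ : ℝ) (hu : u ∈ H2a0 a) (hv : v ∈ H2a0 a) :
    energyForm β γ (u + v) (u + v)
      = energyForm β γ u u + 2 * energyForm β γ u v + energyForm β γ v v := by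
  have h := add_mem_H2a0 ha hu hv
  rw [energyForm_add_left β γ hu hv h, energyForm_comm β γ u, energyForm_comm β γ v,
    energyForm_add_left β γ hu hv hu, energyForm_add_left β γ hu hv hv, energyForm_comm β γ v u]
  ring

/-- Cauchy-Schwarz: the energy of u + t v is a nonnegative quadratic in t, so its discriminant is at
most 0. -/
theorem energyForm_sq_le (ha : IsWeight a) {β γ : ℝ} (hβ : 0 ≤ β) (hγ : 0 ≤ γ)
    (hu : u ∈ H2a0 a) (hv : v ∈ H2a0 a) :
    energyForm β γ u v ^ 2 ≤ energyForm β γ u u * energyForm β γ v v := by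
  have h := discrim_le_zero (a := energyForm β γ v v) (b := 2 * energyForm β γ u v)
    (c := energyForm β γ u u) (fun t => by
      have h1 := energyForm_self_nonneg hβ hγ (u + t • v)
      have h2 := smul_mem_H2a0 ha t hv
      rw [energyForm_add_self ha β γ hu h2, energyForm_comm β γ u (t • v),
        energyForm_smul_left _ _ _ hv, energyForm_smul_left _ _ _ hv,
        energyForm_comm β γ v (t • v),
        energyForm_smul_left _ _ _ hv, energyForm_comm β γ v u] at h1
      linarith)
  rw [discrim] at h
  nlinarith

theorem isNormOn_energyNorm (ha : IsWeight a) {β γ : ℝ} (hβ : 0 ≤ β) (hγ : 0 ≤ γ) :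
    IsNormOn (H2a0 a) (energyNorm β γ) where
  zero_mem := zero_mem_H2a0 ha
  add_mem _ hu _ hv := add_mem_H2a0 ha hu hv
  smul_mem c _ hu := smul_mem_H2a0 ha c hu
  add_le u hu v hv := by
    have h1 : energyForm β γ u v ≤ energyNorm β γ u * energyNorm β γ v := by
      rw [energyNorm_eq_sqrt, energyNorm_eq_sqrt, ← Real.sqrt_mul (energyForm_self_nonneg hβ hγ u)]
      exact Real.le_sqrt_of_sq_le (energyForm_sq_le ha hβ hγ hu hv)
    have hn : ∀ z, 0 ≤ energyNorm β γ z := fun z => Real.sqrt_nonneg _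
    rw [energyNorm_eq_sqrt β γ (u + v)]
    refine Real.sqrt_le_iff.2 ⟨add_nonneg (hn u) (hn v), ?_⟩
    rw [energyForm_add_self ha β γ hu hv, add_sq, energyNorm_sq hβ hγ, energyNorm_sq hβ hγ]
    linarith
  smul_eq c u hu := by
    rw [energyNorm_eq_sqrt, energyNorm_eq_sqrt, energyForm_smul_left _ _ _ hu, energyForm_comm,
      energyForm_smul_left _ _ _ hu, ← mul_assoc, Real.sqrt_mul (mul_self_nonneg c),
      Real.sqrt_mul_self_eq_abs]
  eq_zero u hu h := by
    refine (isBending_of_mem hu).eq_zero (le_antisymm ?_ (integral_D_two_sq_nonneg u))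
    refine (integral_D_two_sq_le_energyForm hβ hγ u).trans ?_
    rw [← energyNorm_sq hβ hγ, h]
    norm_num

theorem equivNormsOn_energyNorm_normD2 (ha : IsWeight a) {β γ : ℝ} (hβ : 0 ≤ β) (hγ : 0 ≤ γ) :
    EquivNormsOn (H2a0 a) (energyNorm β γ) normD2 := by
  -- The boundary terms are nonnegative, whence the constant 1; z(1)² and z'(1)² are each at most ∫
  -- (z'')², whence the other.
  refine ⟨isNormOn_energyNorm ha hβ hγ, ?_, 1, √(1 + β + γ), one_pos,
    Real.sqrt_pos.2 (by positivity), fun u hu => ⟨?_, ?_⟩⟩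
  · rw [normD2_eq_energyNorm]
    exact isNormOn_energyNorm ha le_rfl le_rfl
  · rw [one_mul, energyNorm_eq_sqrt]
    exact Real.sqrt_le_sqrt (integral_D_two_sq_le_energyForm hβ hγ u)
  · rw [energyNorm_eq_sqrt, normD2, ← Real.sqrt_mul (by positivity), energyForm_self]
    refine Real.sqrt_le_sqrt ?_
    have h1 := mul_le_mul_of_nonneg_left (isBending_of_mem hu).valueAt_sq_le hβ
    have h2 := mul_le_mul_of_nonneg_left (isBending_of_mem hu).valueAt_D_sq_le hγ
    linarith

end Linear

/-! ### The best constant in the Hardy-Poincaré inequality -/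

/-- The identity function is the witness; it forces every admissible Hardy-Poincaré constant to be
at least ∫ x²/a > 0. -/
theorem exists_mem_H1a0_integral_D_sq_eq_one {a : ℝ → ℝ} (ha : IsWeight a) :
    ∃ u ∈ H1a0 a, ∫ x, (D 1 u) x ^ 2 ∂vol01 = 1 ∧ 0 < ∫ x, u x ^ 2 / a x ∂vol01 := by
  have hone : MemLp (fun _ : ℝ => (1 : ℝ)) 2 vol01 := memLp_const 1
  let u : Fun01 := AEEqFun.mk id measurable_id.aestronglyMeasurable
  have hid : u =ᵐ[vol01] id := AEEqFun.coeFn_mk _ _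
  have hu : u =ᵐ[vol01] primitive fun _ => 1 := by
    filter_upwards [hid] with x hx
    rw [hx]
    simp [primitive]
  obtain ⟨h1, h2⟩ := ha.mem_H1a0 hone hu
  refine ⟨u, h1, ?_, ?_⟩
  · rw [integral_congr_ae (g := fun _ => (1 : ℝ))
      (by filter_upwards [h2] with x hx; rw [hx, one_pow])]
    simp
  · have hnn : 0 ≤ᵐ[vol01] fun x : ℝ => x ^ 2 / a x := by
      refine (ae_restrict_iff' measurableSet_Ioo).2 (Eventually.of_forall fun x hx => ?_)
      exact div_nonneg (sq_nonneg x) (ha.pos x (Ioo_subset_Ioc_self hx)).le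
    have he : (fun x => u x ^ 2 / a x) =ᵐ[vol01] fun x => x ^ 2 / a x := by
      filter_upwards [hid] with x hx
      rw [hx, id]
    rw [integral_congr_ae he]
    refine (integral_nonneg_of_ae hnn).lt_of_ne fun h0 => ?_
    have hz := (integral_eq_zero_iff_of_nonneg_ae hnn (h1.1.2.congr he)).1 h0.symm
    have hf : ∀ᵐ _ ∂vol01, False := by
      filter_upwards [hz, ae_restrict_mem measurableSet_Ioo] with x hx hx'
      exact (div_pos (pow_pos hx'.1 2) (ha.pos x (Ioo_subset_Ioc_self hx'))).ne' hx
    have : vol01 univ = 0 := by simpa using ae_iff.1 hf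
    simp at this

/-- The admissible constants form an intersection of closed conditions. The set contains ∫ x/a and
is bounded below by a positive number, so its infimum is attained and positive. -/
theorem isLeast_CHP {a : ℝ → ℝ} (ha : IsWeight a) :
    IsLeast (hardyConstants a) (CHP a) ∧ 0 < CHP a := by
  obtain ⟨u₀, hu₀, h1, hpos⟩ := exists_mem_H1a0_integral_D_sq_eq_one ha
  have hlow : ∫ x, u₀ x ^ 2 / a x ∂vol01 ∈ lowerBounds (hardyConstants a) := fun C hC => by
    simpa [h1] using hC u₀ hu₀
  have hne : (hardyConstants a).Nonempty := ⟨∫ x, x / a x ∂vol01, fun u hu => by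
    obtain ⟨hv, hu'⟩ := H1a0_ae_eq hu
    refine (integral_congr_ae ?_).trans_le (ha.integral_primitive_sq_div_le hv)
    filter_upwards [hu'] with x hx
    rw [hx]⟩
  have hcl : IsClosed (hardyConstants a) := by
    have : hardyConstants a = ⋂ u ∈ H1a0 a,
        {C | ∫ x, u x ^ 2 / a x ∂vol01 ≤ C * ∫ x, (D 1 u) x ^ 2 ∂vol01} := by
      ext C
      simp [hardyConstants]
    rw [this]
    exact isClosed_biInter fun u _ =>
      isClosed_le continuous_const (continuous_id.mul continuous_const)
  exact ⟨⟨hcl.csInf_mem hne ⟨_, hlow⟩, fun C hC => csInf_le ⟨_, hlow⟩ hC⟩,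
    hpos.trans_le (le_csInf hne hlow)⟩

theorem normSqL2w_le_CHP_mul {a : ℝ → ℝ} (ha : IsWeight a) {u : Fun01} (hu : u ∈ H2a0 a) :
    normSqL2w a u ≤ CHP a / 2 * ∫ x, (D 2 u) x ^ 2 ∂vol01 := by
  obtain ⟨h1, h2⟩ := isLeast_CHP ha
  have h3 := h1.1 u hu.1
  have hb := isBending_of_mem hu
  have h4 : ∫ x, (D 1 u) x ^ 2 ∂vol01 ≤ (∫ x, (D 2 u) x ^ 2 ∂vol01) / 2 := by
    refine (integral_congr_ae ?_).trans_le (integral_primitive_sq_le hb.1)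
    filter_upwards [hb.weakDeriv.2] with x hx
    rw [hx]
  have h5 := mul_le_mul_of_nonneg_left h4 h2.le
  unfold normSqL2w
  linarith

/-! ### The variational problem -/

section VarSol

variable {a : ℝ → ℝ} {β γ l m : ℝ} {z : Fun01}

theorem IsVarSol.energyForm_eq (hz : IsVarSol a β γ l m z) {φ : Fun01} (hφ : φ ∈ H2a0 a) :
    energyForm β γ z φ = l * valueAt φ 1 + m * valueAt (D 1 φ) 1 :=
  hz.2 φ hφ

/-- The difference of two solutions, used as its own test function, has zero energy. -/
theorem IsVarSol.unique (ha : IsWeight a) (hβ : 0 ≤ β) (hγ : 0 ≤ γ) {y : Fun01}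
    (hz : IsVarSol a β γ l m z) (hy : IsVarSol a β γ l m y) : z = y := by
  have hy' := smul_mem_H2a0 ha (-1) hy.1
  have hd := add_mem_H2a0 ha hz.1 hy'
  have h : energyNorm β γ (z + (-1 : ℝ) • y) = 0 := by
    rw [energyNorm_eq_sqrt, energyForm_add_left β γ hz.1 hy' hd,
      energyForm_smul_left _ _ _ hy.1, hz.energyForm_eq hd, hy.energyForm_eq hd]
    simp
  have := (isNormOn_energyNorm ha hβ hγ).eq_zero _ hd h
  rwa [neg_one_smul, ← sub_eq_add_neg, sub_eq_zero] at this

/-- Testing with z itself gives |||z|||² = l z(1) + m z'(1), and both boundary values are at most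
|||z||| in modulus; one factor |||z||| then cancels. -/
theorem IsVarSol.energyNorm_sq_le (hβ : 0 ≤ β) (hγ : 0 ≤ γ) (hz : IsVarSol a β γ l m z) :
    energyNorm β γ z ^ 2 ≤ (|l| + |m|) ^ 2 := by
  have hn : 0 ≤ energyNorm β γ z := Real.sqrt_nonneg _
  have hb := isBending_of_mem hz.1
  have hle := integral_D_two_sq_le_energyForm hβ hγ z
  rw [← energyNorm_sq hβ hγ] at hle
  have h1 : |valueAt z 1| ≤ energyNorm β γ z :=
    abs_le_of_sq_le_sq (hb.valueAt_sq_le.trans hle) hn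
  have h2 : |valueAt (D 1 z) 1| ≤ energyNorm β γ z :=
    abs_le_of_sq_le_sq (hb.valueAt_D_sq_le.trans hle) hn
  have h3 : energyNorm β γ z ^ 2 ≤ (|l| + |m|) * energyNorm β γ z := by
    rw [energyNorm_sq hβ hγ, hz.energyForm_eq hz.1]
    have e1 : l * valueAt z 1 ≤ |l| * energyNorm β γ z :=
      (le_abs_self _).trans ((abs_mul _ _).trans_le
        (mul_le_mul_of_nonneg_left h1 (abs_nonneg l)))
    have e2 : m * valueAt (D 1 z) 1 ≤ |m| * energyNorm β γ z :=
      (le_abs_self _).trans ((abs_mul _ _).trans_le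
        (mul_le_mul_of_nonneg_left h2 (abs_nonneg m)))
    linarith
  have h4 : energyNorm β γ z ≤ |l| + |m| := by
    rcases hn.eq_or_lt with h0 | h0
    · rw [← h0]; positivity
    · rw [pow_two] at h3
      exact le_of_mul_le_mul_right h3 h0
  exact pow_le_pow_left₀ hn h4 2

theorem IsVarSol.normSqL2w_le (ha : IsWeight a) (hβ : 0 ≤ β) (hγ : 0 ≤ γ)
    (hz : IsVarSol a β γ l m z) :
    normSqL2w a z ≤ (4 * CHP a + 1) * (|l| + |m|) ^ 2 := by
  have hC := (isLeast_CHP ha).2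
  have h1 := integral_D_two_sq_le_energyForm hβ hγ z
  rw [← energyNorm_sq hβ hγ] at h1
  have h2 := h1.trans (hz.energyNorm_sq_le hβ hγ)
  refine (normSqL2w_le_CHP_mul ha hz.1).trans ?_
  -- The argument yields the smaller factor `CHP a / 2`, so the stated constant leaves room.
  exact mul_le_mul (by linarith) h2 (integral_D_two_sq_nonneg z) (by linarith)

end VarSol

/-! ### The cubic polynomials `p x² + q x³` -/

theorem primitive_cubic_deriv_two (p q x : ℝ) :
    primitive (fun x => 2 * p + 6 * q * x) x = 2 * p * x + 3 * q * x ^ 2 := by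
  unfold primitive
  rw [intervalIntegral.integral_add (by simp) (Continuous.intervalIntegrable (by fun_prop) _ _),
    intervalIntegral.integral_const, intervalIntegral.integral_const_mul, integral_id]
  simp only [smul_eq_mul]
  ring

theorem primitive_cubic_deriv (p q x : ℝ) :
    primitive (fun x => 2 * p * x + 3 * q * x ^ 2) x = p * x ^ 2 + q * x ^ 3 := by
  unfold primitive
  rw [intervalIntegral.integral_add (Continuous.intervalIntegrable (by fun_prop) _ _)
      (Continuous.intervalIntegrable (by fun_prop) _ _),
    intervalIntegral.integral_const_mul, intervalIntegral.integral_const_mul, integral_id,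
    integral_pow]
  norm_num
  ring

/-- The class of `p x² + q x³`. -/
noncomputable def cubic (p q : ℝ) : Fun01 :=
  AEEqFun.mk (fun x => p * x ^ 2 + q * x ^ 3)
    (Continuous.aestronglyMeasurable (by fun_prop))

theorem isBending_cubic (p q : ℝ) : IsBending (cubic p q) fun x => 2 * p + 6 * q * x := by
  refine ⟨memLp_of_continuousOn (by fun_prop), (AEEqFun.coeFn_mk _ _).trans ?_⟩
  refine Eventually.of_forall fun x => ?_
  rw [funext (primitive_cubic_deriv_two p q), primitive_cubic_deriv]

theorem valueAt_cubic (p q : ℝ) :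
    valueAt (cubic p q) 1 = p + q ∧ valueAt (D 1 (cubic p q)) 1 = 2 * p + 3 * q := by
  rw [(isBending_cubic p q).valueAt_eq, (isBending_cubic p q).valueAt_D_eq,
    funext (primitive_cubic_deriv_two p q), primitive_cubic_deriv]
  constructor <;> ring

theorem cubic_D_three (p q : ℝ) :
    WeaklyDiff (D 2 (cubic p q)) ∧ D 3 (cubic p q) =ᵐ[vol01] fun _ => 6 * q := by
  refine weakDeriv_of_ae_eq_primitive (c := 2 * p) (integrable_const _)
    ((isBending_cubic p q).weakDeriv_two.2.trans (Eventually.of_forall fun x => ?_))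
  simp [primitive, mul_comm x, mul_assoc]

theorem cubic_D_four (p q : ℝ) :
    WeaklyDiff (D 3 (cubic p q)) ∧ D 4 (cubic p q) =ᵐ[vol01] 0 := by
  refine weakDeriv_of_ae_eq_primitive (c := 6 * q) (integrable_zero _ _ _)
    ((cubic_D_three p q).2.trans (Eventually.of_forall fun x => ?_))
  simp [primitive]

theorem opA_cubic (a : ℝ → ℝ) (p q : ℝ) : opA a (cubic p q) =ᵐ[vol01] 0 := by
  filter_upwards [(cubic_D_four p q).2] with x hx
  simp [opA, hx]

theorem cubic_mem_domA {a : ℝ → ℝ} (ha : IsWeight a) (p q : ℝ) : cubic p q ∈ domA a := by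
  have hb := isBending_cubic p q
  refine ⟨hb.mem_H2a0 ha, ?_, MemLp.ae_eq (opA_cubic a p q).symm MemLp.zero, ?_⟩
  · intro i hi
    interval_cases i
    · exact hb.weakDeriv.1
    · exact hb.weakDeriv_two.1
    · exact (cubic_D_three p q).1
    · exact (cubic_D_four p q).1
  · refine (integrable_zero ℝ ℝ vol01).congr ?_
    filter_upwards [opA_cubic a p q] with x hx
    simp [hx]

theorem hasValueAt_cubic_D_two (p q : ℝ) : HasValueAt (D 2 (cubic p q)) 1 (2 * p + 6 * q) := by
  simpa using hasValueAt_of_continuousOn (isBending_cubic p q).weakDeriv_two.2 (by fun_prop)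
    (right_mem_Icc.2 zero_le_one)

theorem hasValueAt_cubic_D_three (p q : ℝ) : HasValueAt (D 3 (cubic p q)) 1 (6 * q) :=
  hasValueAt_of_continuousOn (cubic_D_three p q).2 continuousOn_const
    (right_mem_Icc.2 zero_le_one)

/-- The variational problem is solved by the cubic that satisfies the boundary conditions
at `1`. -/
theorem isVarSol_cubic {a : ℝ → ℝ} (ha : IsWeight a) {β γ l m p q : ℝ}
    (hl : β * (p + q) - 6 * q = l) (hm : γ * (2 * p + 3 * q) + (2 * p + 6 * q) = m) :
    IsVarSol a β γ l m (cubic p q) := by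
  refine ⟨(isBending_cubic p q).mem_H2a0 ha, fun φ hφ => ?_⟩
  have h1 : ∫ x, (D 2 (cubic p q)) x * (D 2 φ) x ∂vol01
      = ∫ x, (2 * p + 6 * q * x) * (D 2 φ) x ∂vol01 := by
    refine integral_congr_ae ?_
    filter_upwards [(isBending_cubic p q).weakDeriv_two.2] with x hx
    rw [hx]
  -- The integral equals (2p + 6q) φ'(1) - 6q φ(1); the boundary equations match the coefficients of
  -- φ(1) and φ'(1).
  rw [h1, (isBending_of_mem hφ).integral_affine_mul, (valueAt_cubic p q).1,
    (valueAt_cubic p q).2, ← hl, ← hm]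
  ring

/-- Cramer's rule; the denominator is the determinant β(3γ + 6) - (β - 6)(2γ + 2). -/
theorem exists_cubic_coeffs {β γ : ℝ} (hβ : 0 ≤ β) (hγ : 0 ≤ γ) (l m : ℝ) :
    ∃ p q : ℝ, β * (p + q) - 6 * q = l ∧ γ * (2 * p + 3 * q) + (2 * p + 6 * q) = m := by
  have hd : β * γ + 4 * β + 12 * γ + 12 ≠ 0 := by positivity
  refine ⟨((3 * γ + 6) * l - (β - 6) * m) / (β * γ + 4 * β + 12 * γ + 12),
    (β * m - (2 * γ + 2) * l) / (β * γ + 4 * β + 12 * γ + 12), ?_, ?_⟩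
  · field_simp
    ring
  · field_simp
    ring

end DegBeam

theorem proposition2p6 (a : ℝ → ℝ) (ha : DegBeam.IsWD a ∨ DegBeam.IsSD a)
    (β γ : ℝ) (hβ : 0 ≤ β) (hγ : 0 ≤ γ) :
    DegBeam.EquivNormsOn (DegBeam.H2a0 a) (DegBeam.energyNorm β γ) DegBeam.normD2 ∧
    IsLeast (DegBeam.hardyConstants a) (DegBeam.CHP a) ∧ 0 < DegBeam.CHP a ∧
    ∀ l m : ℝ,
      (∃! z : DegBeam.Fun01, DegBeam.IsVarSol a β γ l m z) ∧
      ∀ z : DegBeam.Fun01, DegBeam.IsVarSol a β γ l m z →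
        DegBeam.normSqL2w a z ≤ (4 * DegBeam.CHP a + 1) * (|l| + |m|) ^ 2 ∧
        DegBeam.energyNorm β γ z ^ 2 ≤ (|l| + |m|) ^ 2 ∧
        z ∈ DegBeam.domA a ∧
        DegBeam.opA a z =ᵐ[DegBeam.vol01] 0 ∧
        (∃ z2 z3 : ℝ,
          DegBeam.HasValueAt (DegBeam.D 2 z) 1 z2 ∧ DegBeam.HasValueAt (DegBeam.D 3 z) 1 z3 ∧
          β * DegBeam.valueAt z 1 - z3 = l ∧
          γ * DegBeam.valueAt (DegBeam.D 1 z) 1 + z2 = m) := by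
  have hw := DegBeam.isWeight_of_isWD_or_isSD ha
  refine ⟨DegBeam.equivNormsOn_energyNorm_normD2 hw hβ hγ, (DegBeam.isLeast_CHP hw).1,
    (DegBeam.isLeast_CHP hw).2, fun l m => ?_⟩
  obtain ⟨p, q, hl, hm⟩ := DegBeam.exists_cubic_coeffs hβ hγ l m
  have hsol := DegBeam.isVarSol_cubic hw hl hm
  refine ⟨⟨_, hsol, fun y hy => hy.unique hw hβ hγ hsol⟩, fun z hz => ?_⟩
  -- By uniqueness an arbitrary solution is the cubic, so its regularity and boundary values are
  -- explicit.
  obtain rfl := hz.unique hw hβ hγ hsol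
  refine ⟨hz.normSqL2w_le hw hβ hγ, hz.energyNorm_sq_le hβ hγ, DegBeam.cubic_mem_domA hw p q,
    DegBeam.opA_cubic a p q, 2 * p + 6 * q, 6 * q, DegBeam.hasValueAt_cubic_D_two p q,
    DegBeam.hasValueAt_cubic_D_three p q, ?_, ?_⟩
  · rw [(DegBeam.valueAt_cubic p q).1, hl]
  · rw [(DegBeam.valueAt_cubic p q).2, hm]
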